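/- Let $\mathbb{BC}=\{z_1+jz_2:\ z_1,z_2\in\mathbb C\}$ be the commutative ring of bicomplex numbers ($j^2=-1$, $ij=ji$), with Euclidean norm $|z_1+jz_2|^2=|z_1|^2+|z_2|^2$ and idempotents $e_\pm=\frac{1\pm ij}{2}$; every $Z=z_1+jz_2$ is uniquely $Z=\alpha e_++\beta e_-$ with $\alpha=z_1-iz_2$, $\beta=z_1+iz_2\in\mathbb C$, and one sets $e^{Z}=e^{\alpha}e_++e^{\beta}e_-$ and $\sqrt Z=\sqrt\alpha\,e_++\sqrt\beta\,e_-$ (principal roots). For $\sigma>0$ let $L^{2,\sigma}_{\mathbb{BC}}(\mathbb R)$ be the space of (classes of a.e. equal) functions $\psi:\mathbb R\to\mathbb{BC}$ that are square integrable with respect to the measure $\sqrt{\sigma/\pi}\,e^{-\sigma x^2}dx$. Let $\sigma>0$ and let $\theta=\alpha_\theta e_++\beta_\theta e_-$ with $|\alpha_\theta|=|\beta_\theta|=1$ be such that $1-\theta^2$ is invertible in $\mathbb{BC}$ (that is, $\alpha_\theta\neq\pm1$ and $\beta_\theta\ne\pm1$). The bicomplex fractional Fourier transform of $\psi\in L^{2,\sigma}_{\mathbb{BC}}(\mathbb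 R)$ is $$\mathcal F^\sigma_\theta\psi(y)=\frac{\sqrt{\sigma/\pi}}{\sqrt{1-\theta^2}}\int_{\mathbb R}\psi(x)\,e^{-\frac{\sigma}{1-\theta^2}(x-\theta y)^2}\,dx,$$ where the integral is understood as the limit in $L^{2,\sigma}_{\mathbb{BC}}(\mathbb R)$, as $R\to\infty$, of the integrals over $[-R,R]$. Then $\mathcal F^\sigma_\theta$ is well defined on $L^{2,\sigma}_{\mathbb{BC}}(\mathbb R)$, that is, this limit exists for every $\psi\in L^{2,\sigma}_{\mathbb{BC}}(\mathbb R)$, and it is injective: if $\psi_1,\psi_2\in L^{2,\sigma}_{\mathbb{BC}}(\mathbb R)$ satisfy $\mathcal F^\sigma_\theta\psi_1=\mathcal F^\sigma_\theta\psi_2$, then $\psi_1=\psi_2$. -/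

import Mathlib

open MeasureTheory Filter Topology

noncomputable section

/-- The bicomplex numbers `Z = z₁ + j z₂` with `z₁ z₂ : ℂ` and `j ^ 2 = -1`; here `z₁ = Z.re`,
`z₂ = Z.im` and `j = QuadraticAlgebra.omega`. -/
abbrev Bicomplex : Type := QuadraticAlgebra ℂ (-1) 0

namespace Bicomplex

/-- The component `α = z₁ - i z₂` in the idempotent decomposition `Z = α e₊ + β e₋`. -/
def plus (Z : Bicomplex) : ℂ := Z.re - Complex.I * Z.im

/-- The component `β = z₁ + i z₂` in the idempotent decomposition `Z = α e₊ + β e₋`. -/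
def minus (Z : Bicomplex) : ℂ := Z.re + Complex.I * Z.im

/-- The idempotent `e₊ = (1 + i j) / 2`. -/
def ePlus : Bicomplex := ⟨1 / 2, Complex.I / 2⟩

/-- The idempotent `e₋ = (1 - i j) / 2`. -/
def eMinus : Bicomplex := ⟨1 / 2, -(Complex.I / 2)⟩

/-- The bicomplex number `α e₊ + β e₋`. -/
def ofIdem (α β : ℂ) : Bicomplex := α • ePlus + β • eMinus

theorem plus_ofIdem (α β : ℂ) : (ofIdem α β).plus = α := by
  simp only [ofIdem, ePlus, eMinus, plus, QuadraticAlgebra.re_add, QuadraticAlgebra.im_add,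
    QuadraticAlgebra.re_smul, QuadraticAlgebra.im_smul, smul_eq_mul]
  linear_combination (β - α) / 2 * Complex.I_mul_I

theorem minus_ofIdem (α β : ℂ) : (ofIdem α β).minus = β := by
  simp only [ofIdem, ePlus, eMinus, minus, QuadraticAlgebra.re_add, QuadraticAlgebra.im_add,
    QuadraticAlgebra.re_smul, QuadraticAlgebra.im_smul, smul_eq_mul]
  linear_combination (α - β) / 2 * Complex.I_mul_I

theorem ofIdem_plus_minus (Z : Bicomplex) : ofIdem Z.plus Z.minus = Z := by
  ext
  · simp only [ofIdem, ePlus, eMinus, minus, plus, QuadraticAlgebra.re_add,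
      QuadraticAlgebra.re_smul, smul_eq_mul]
    ring
  · simp only [ofIdem, ePlus, eMinus, minus, plus, QuadraticAlgebra.im_add,
      QuadraticAlgebra.im_smul, smul_eq_mul]
    linear_combination (-Z.im) * Complex.I_mul_I

/-- The identification of the bicomplex numbers with the Euclidean space `ℂ² = ℝ⁴`. -/
def toEuclidean : Bicomplex →ₗ[ℝ] WithLp 2 (ℂ × ℂ) where
  toFun Z := WithLp.toLp 2 (Z.re, Z.im)
  map_add' _ _ := rfl
  map_smul' _ _ := rfl

theorem toEuclidean_injective : Function.Injective toEuclidean := by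
  intro Z W h
  have h' : (Z.re, Z.im) = (W.re, W.im) := congrArg WithLp.ofLp h
  exact QuadraticAlgebra.ext (congrArg Prod.fst h') (congrArg Prod.snd h')

/-- The Euclidean norm `|Z| ^ 2 = |z₁| ^ 2 + |z₂| ^ 2`. -/
instance : NormedAddCommGroup Bicomplex :=
  NormedAddCommGroup.induced Bicomplex (WithLp 2 (ℂ × ℂ)) toEuclidean toEuclidean_injective

instance : NormedSpace ℝ Bicomplex :=
  NormedSpace.induced ℝ Bicomplex (WithLp 2 (ℂ × ℂ)) toEuclidean

theorem norm_sq_eq (Z : Bicomplex) : ‖Z‖ ^ 2 = ‖Z.re‖ ^ 2 + ‖Z.im‖ ^ 2 :=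
  WithLp.prod_norm_sq_eq_of_L2 (toEuclidean Z)

/-- The bicomplex exponential `e ^ (α e₊ + β e₋) = e ^ α e₊ + e ^ β e₋`. -/
def exp (Z : Bicomplex) : Bicomplex := ofIdem (Complex.exp Z.plus) (Complex.exp Z.minus)

/-- The bicomplex square root `√(α e₊ + β e₋) = √α e₊ + √β e₋`, with principal complex roots. -/
def sqrt (Z : Bicomplex) : Bicomplex := ofIdem (Z.plus ^ (1 / 2 : ℂ)) (Z.minus ^ (1 / 2 : ℂ))

/-- The normalisation constant `(σ / π) ^ (1 / 2)`. -/
def gaussConst (σ : ℝ) : ℝ := Real.sqrt (σ / Real.pi)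

/-- The normalised Gaussian measure `(σ / π) ^ (1 / 2) e ^ (-σ x²) dx` on the real line. -/
def gaussMeasure (σ : ℝ) : Measure ℝ :=
  volume.withDensity fun x => ENNReal.ofReal (gaussConst σ * Real.exp (-σ * x ^ 2))

/-- The space of (classes of) bicomplex valued functions on the real line that are square
integrable for the Gaussian measure. -/
abbrev L2 (σ : ℝ) : Type := Lp Bicomplex 2 (gaussMeasure σ)

/-- The kernel `e ^ (-σ / (1 - θ²) (x - θ y)²)`; `Ring.inverse` is the inverse of a unit. -/
def bfrftKernel (σ : ℝ) (θ : Bicomplex) (x y : ℝ) : Bicomplex :=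
  exp (-(algebraMap ℝ Bicomplex σ * Ring.inverse (1 - θ ^ 2) *
    (algebraMap ℝ Bicomplex x - θ * algebraMap ℝ Bicomplex y) ^ 2))

/-- The integral of the fractional Fourier transform, taken over `[-R, R]`. -/
def bfrftTrunc (σ : ℝ) (θ : Bicomplex) (R : ℝ) (ψ : ℝ → Bicomplex) (y : ℝ) : Bicomplex :=
  algebraMap ℝ Bicomplex (gaussConst σ) * Ring.inverse (sqrt (1 - θ ^ 2)) *
    ∫ x in (-R)..R, ψ x * bfrftKernel σ θ x y

/-- `φ` is the bicomplex fractional Fourier transform of `ψ`: the integral over the real line,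
which need not converge absolutely, is the limit in mean of the integrals over `[-R, R]`. -/
def IsBFrFT (σ : ℝ) (θ : Bicomplex) (ψ φ : L2 σ) : Prop :=
  Tendsto (fun R : ℝ => eLpNorm (fun y => bfrftTrunc σ θ R ψ y - φ y) 2 (gaussMeasure σ))
    atTop (𝓝 0)

open Classical in
/-- The bicomplex fractional Fourier transform on the square integrable functions. The value `0`
where the limit in mean does not exist is a convention. -/
def bfrft (σ : ℝ) (θ : Bicomplex) (ψ : L2 σ) : L2 σ :=
  if h : ∃ φ : L2 σ, IsBFrFT σ θ ψ φ then h.choose else 0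

end Bicomplex

end

/-! The components along `ePlus` and `eMinus` are ring homomorphisms to ℂ, so the transform splits
into two scalar transforms with a parameter a, |a| = 1, a² ≠ 1. Put c = 1/(1 - a²). On the unit
circle Re c = 1/2, ca is purely imaginary and ca² = c - 1. Hence the kernel is a chirp in x of
modulus e^(-σx²/2), a pure phase in xy, and a chirp in y of modulus e^(σy²/2) (`frftKernel_eq`).

The first chirp carries the Gaussian L² space to L²(dx), the phase is a dilated Fourier kernel, and
the last chirp carries L²(dx) back. Each step preserves norms up to a nonzero constant
(`norm_chirp`, `eLpNorm_dilateChirp`), so Plancherel yields both convergence of the truncations and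
injectivity. -/

noncomputable section

namespace Bicomplex

open scoped FourierTransform SchwartzMap ENNReal

/-! ### Plancherel on L¹ ∩ L², and truncation in L². -/

/-- On `L¹ ∩ L²` the Fourier transform of `L²` is given by the Fourier integral. -/
theorem fourier_toLp_ae_eq {h : ℝ → ℂ} (h1 : Integrable h) (h2 : MemLp h 2) :
    (𝓕 (h2.toLp h) : Lp ℂ 2 (volume : Measure ℝ)) =ᵐ[volume] 𝓕 h := by
  have hcont : Continuous (𝓕 h) :=
    VectorFourier.fourierIntegral_continuous Real.continuous_fourierChar
      (by exact continuous_inner) h1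
  -- Both sides are tested against smooth compactly supported g: the distributional definition on
  -- one side and Fubini on the other move the transform onto g.
  refine ae_eq_of_integral_contDiff_smul_eq
    ((Lp.memLp _).locallyIntegrable (by norm_num)) hcont.locallyIntegrable ?_
  intro g hg hgc
  let G : 𝓢(ℝ, ℂ) := HasCompactSupport.toSchwartzMap (f := fun x => (g x : ℂ))
    (hgc.comp_left (g := fun r : ℝ => (r : ℂ)) rfl) (Complex.ofRealCLM.contDiff.comp hg)
  have hG : ∀ x, G x = (g x : ℂ) := fun x => rfl
  have key := congrArg (fun T : 𝓢'(ℝ, ℂ) => T G)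
    (Lp.fourier_toTemperedDistribution_eq (h2.toLp h))
  simp only [TemperedDistribution.fourier_apply, Lp.toTemperedDistribution_apply] at key
  have e1 : ∫ x, g x • (𝓕 (h2.toLp h) : Lp ℂ 2 (volume : Measure ℝ)) x =
      ∫ x, G x • (𝓕 (h2.toLp h) : Lp ℂ 2 (volume : Measure ℝ)) x := by
    simp [hG]
  have e2 : ∫ x, g x • 𝓕 h x = ∫ x, G x • 𝓕 h x := by
    simp [hG]
  rw [e1, e2, ← key]
  have e3 : ∫ x, (𝓕 G) x • (h2.toLp h) x = ∫ x, 𝓕 (G : ℝ → ℂ) x • h x := by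
    refine integral_congr_ae ?_
    filter_upwards [h2.coeFn_toLp] with x hx
    rw [hx, SchwartzMap.fourier_coe]
  rw [e3]
  have := VectorFourier.integral_fourierIntegral_smul_eq_flip (L := innerₗ ℝ)
    (μ := volume) (ν := volume) (f := G) (g := h) Real.continuous_fourierChar
    (by exact continuous_inner) G.integrable h1
  rw [flip_innerₗ] at this
  exact this

/-- **Plancherel's theorem** for the Fourier integral on `L¹ ∩ L²`. -/
theorem eLpNorm_fourier_eq {h : ℝ → ℂ} (h1 : Integrable h) (h2 : MemLp h 2) :
    eLpNorm (𝓕 h) 2 = eLpNorm h 2 := by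
  rw [← eLpNorm_congr_ae (fourier_toLp_ae_eq h1 h2), ← eLpNorm_congr_ae h2.coeFn_toLp,
    ← Lp.enorm_def, ← Lp.enorm_def, ← ofReal_norm, ← ofReal_norm, Lp.norm_fourier_eq]

theorem tendsto_eLpNorm_indicator_Ioc_sub {h : ℝ → ℂ} (h2 : MemLp h 2) :
    Tendsto (fun R : ℝ => eLpNorm (fun x => (Set.Ioc (-R) R).indicator h x - h x) 2 volume)
      atTop (𝓝 0) := by
  have hlim : Tendsto (fun R : ℝ => ∫⁻ x, ‖(Set.Ioc (-R) R).indicator h x - h x‖ₑ ^ (2 : ℝ))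
      atTop (𝓝 (∫⁻ _ : ℝ, 0)) := by
    refine tendsto_lintegral_filter_of_dominated_convergence'
      (fun x => ‖h x‖ₑ ^ (2 : ℝ)) ?_ ?_ ?_ ?_
    · refine Eventually.of_forall fun R => ?_
      exact ((h2.1.indicator measurableSet_Ioc).sub h2.1).enorm.pow_const _
    · refine Eventually.of_forall fun R => ae_of_all _ fun x => ?_
      refine ENNReal.rpow_le_rpow ?_ (by norm_num)
      by_cases hx : x ∈ Set.Ioc (-R) R <;> simp [hx]
    · have := h2.eLpNorm_lt_top
      rw [eLpNorm_lt_top_iff_lintegral_rpow_enorm_lt_top (by norm_num) (by norm_num)] at this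
      exact this.ne
    · refine ae_of_all _ fun x => ?_
      refine tendsto_const_nhds.congr' ?_
      filter_upwards [eventually_gt_atTop |x|] with R hR
      have hx : x ∈ Set.Ioc (-R) R := ⟨(abs_lt.1 hR).1, (abs_lt.1 hR).2.le⟩
      simp [hx]
  rw [lintegral_zero] at hlim
  have := hlim.ennrpow_const (1 / 2 : ℝ)
  simpa [eLpNorm_eq_lintegral_rpow_enorm_toReal] using this

/-! ### Gaussian measure against Lebesgue measure. -/

/-- The weight e^(-σx²) is the square of e^(-σx²/2), so it can be absorbed into the function. No
measurability is assumed, since the density is measurable and finite. -/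
theorem eLpNorm_gaussMeasure (σ : ℝ) {f : ℝ → ℂ} {g : ℝ → ℂ}
    (hfg : ∀ x, ‖g x‖ = Real.exp (-σ * x ^ 2 / 2) * ‖f x‖) :
    eLpNorm f 2 (gaussMeasure σ) =
      ENNReal.ofReal (gaussConst σ) ^ (1 / 2 : ℝ) * eLpNorm g 2 volume := by
  have hm : Measurable fun x : ℝ => ENNReal.ofReal (gaussConst σ * Real.exp (-σ * x ^ 2)) := by
    fun_prop
  rw [eLpNorm_eq_lintegral_rpow_enorm_toReal (by norm_num) (by norm_num),
    eLpNorm_eq_lintegral_rpow_enorm_toReal (by norm_num) (by norm_num), ENNReal.toReal_ofNat,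
    ← ENNReal.mul_rpow_of_nonneg _ _ (by norm_num), gaussMeasure,
    lintegral_withDensity_eq_lintegral_mul_non_measurable _ hm (by simp),
    ← lintegral_const_mul' _ _ ENNReal.ofReal_ne_top]
  congr 1
  refine lintegral_congr fun x => ?_
  simp only [Pi.mul_apply]
  rw [← ofReal_norm (g x), hfg, ENNReal.ofReal_mul (Real.exp_pos _).le, ofReal_norm,
    ENNReal.mul_rpow_of_nonneg _ _ (by norm_num), ← mul_assoc,
    ENNReal.ofReal_mul (show 0 ≤ gaussConst σ from Real.sqrt_nonneg _),
    ENNReal.ofReal_rpow_of_pos (Real.exp_pos _),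
    ← Real.exp_mul]
  congr 4
  ring

theorem gaussConst_pos {σ : ℝ} (hσ : 0 < σ) : 0 < gaussConst σ :=
  Real.sqrt_pos.2 (div_pos hσ Real.pi_pos)

theorem volume_absolutelyContinuous_gaussMeasure {σ : ℝ} (hσ : 0 < σ) :
    (volume : Measure ℝ) ≪ gaussMeasure σ := by
  refine withDensity_absolutelyContinuous' (by fun_prop) (ae_of_all _ fun x => ?_)
  have := gaussConst_pos hσ
  simp only [ne_eq, ENNReal.ofReal_eq_zero, not_le]
  positivity

theorem gaussMeasure_absolutelyContinuous (σ : ℝ) : gaussMeasure σ ≪ volume :=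
  withDensity_absolutelyContinuous _ _

/-! ### The scalar kernel on the unit circle. -/

/-- The scalar kernel `e ^ (-σ / (1 - a²) (x - a y)²)`. -/
def frftKernel (σ : ℝ) (a : ℂ) (x y : ℝ) : ℂ :=
  Complex.exp (-(σ * (1 - a ^ 2)⁻¹ * (x - a * y) ^ 2))

section UnitCircle

variable {a : ℂ}

theorem conj_eq_inv_of_norm_eq_one (ha : ‖a‖ = 1) : (starRingEnd ℂ) a = a⁻¹ := by
  rw [Complex.inv_def, Complex.normSq_eq_norm_sq, ha]
  simp

/-- Conjugation is a ↦ a⁻¹ on the circle, so it sends c = 1/(1 - a²) to -a²c, and c - a²c = 1. -/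
theorem re_inv_one_sub_sq (ha : ‖a‖ = 1) (ha' : 1 - a ^ 2 ≠ 0) :
    ((1 - a ^ 2)⁻¹).re = 1 / 2 := by
  have ha0 : a ≠ 0 := by rintro rfl; simp at ha
  have h : (1 - a ^ 2)⁻¹ + (starRingEnd ℂ) ((1 - a ^ 2)⁻¹) = 1 := by
    rw [map_inv₀, map_sub, map_pow, map_one, conj_eq_inv_of_norm_eq_one ha]
    have h2 : 1 - a⁻¹ ^ 2 ≠ 0 := by
      intro h
      apply ha'
      field_simp at h
      linear_combination -h
    have h3 : (1 - a⁻¹ ^ 2)⁻¹ = -a ^ 2 * (1 - a ^ 2)⁻¹ := by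
      rw [inv_eq_iff_eq_inv, mul_inv, inv_inv]
      field_simp
      ring
    rw [h3]
    linear_combination mul_inv_cancel₀ ha'
  have := congrArg Complex.re h
  simp only [Complex.add_re, Complex.conj_re, Complex.one_re] at this
  linarith

/-- The number ca = 1/(a⁻¹ - a) changes sign under a ↦ a⁻¹, that is, under conjugation. This makes
the cross term of the exponent a pure phase. -/
theorem inv_one_sub_sq_mul_self (ha : ‖a‖ = 1) (ha' : 1 - a ^ 2 ≠ 0) :
    (1 - a ^ 2)⁻¹ * a = Complex.I * (((1 - a ^ 2)⁻¹ * a).im : ℂ) := by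
  have ha0 : a ≠ 0 := by rintro rfl; simp at ha
  have h : (starRingEnd ℂ) ((1 - a ^ 2)⁻¹ * a) = -((1 - a ^ 2)⁻¹ * a) := by
    rw [map_mul, map_inv₀, map_sub, map_pow, map_one, conj_eq_inv_of_norm_eq_one ha,
      ← mul_inv, ← neg_mul, ← inv_neg, ← div_eq_inv_mul, inv_eq_iff_eq_inv, inv_div]
    field_simp
    ring
  have hre := congrArg Complex.re h
  simp only [Complex.conj_re, Complex.neg_re] at hre
  apply Complex.ext <;> simp only [Complex.mul_re, Complex.mul_im, Complex.I_re, Complex.I_im,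
    Complex.ofReal_re, Complex.ofReal_im] at hre ⊢ <;> linarith

theorem im_inv_one_sub_sq_mul_self_ne_zero (ha : ‖a‖ = 1) (ha' : 1 - a ^ 2 ≠ 0) :
    ((1 - a ^ 2)⁻¹ * a).im ≠ 0 := by
  intro h
  have ha0 : a ≠ 0 := by rintro rfl; simp at ha
  have := inv_one_sub_sq_mul_self ha ha'
  rw [h] at this
  simp [ha0, ha'] at this

theorem frftKernel_eq (σ : ℝ) (ha : ‖a‖ = 1) (ha' : 1 - a ^ 2 ≠ 0) (x y : ℝ) :
    frftKernel σ a x y =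
      Complex.exp (-(σ * ((1 - a ^ 2)⁻¹ - 1) * y ^ 2)) *
        (Complex.exp (-(σ * (1 - a ^ 2)⁻¹ * x ^ 2)) *
          Complex.exp (((2 * σ * ((1 - a ^ 2)⁻¹ * a).im * x * y : ℝ) : ℂ) * Complex.I)) := by
  rw [frftKernel, ← Complex.exp_add, ← Complex.exp_add]
  congr 1
  push_cast
  linear_combination (2 * σ * x * y) * inv_one_sub_sq_mul_self ha ha' +
    (σ * y ^ 2) * mul_inv_cancel₀ ha'

/-- The function `f` multiplied by the chirp `e ^ (-σ / (1 - a²) x²)`. -/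
def chirp (σ : ℝ) (a : ℂ) (f : ℝ → ℂ) (x : ℝ) : ℂ :=
  f x * Complex.exp (-(σ * (1 - a ^ 2)⁻¹ * x ^ 2))

theorem norm_exp_chirp (σ : ℝ) (c : ℂ) (x : ℝ) :
    ‖Complex.exp (-(σ * c * x ^ 2))‖ = Real.exp (-(σ * c.re * x ^ 2)) := by
  rw [Complex.norm_exp]
  congr 1
  rw [← Complex.ofReal_pow, Complex.neg_re, Complex.re_mul_ofReal, Complex.re_ofReal_mul]

/-- Since Re c = 1/2, the chirp has as modulus the square root of the Gaussian weight (up to the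
constant), which is what `eLpNorm_gaussMeasure` requires. -/
theorem norm_chirp (σ : ℝ) (ha : ‖a‖ = 1) (ha' : 1 - a ^ 2 ≠ 0) (f : ℝ → ℂ) (x : ℝ) :
    ‖chirp σ a f x‖ = Real.exp (-σ * x ^ 2 / 2) * ‖f x‖ := by
  rw [chirp, norm_mul, norm_exp_chirp, re_inv_one_sub_sq ha ha', mul_comm]
  ring_nf

variable {σ : ℝ} {f : ℝ → ℂ}

theorem memLp_chirp (hσ : 0 < σ) (ha : ‖a‖ = 1) (ha' : 1 - a ^ 2 ≠ 0)
    (hf : MemLp f 2 (gaussMeasure σ)) : MemLp (chirp σ a f) 2 volume := by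
  refine ⟨(hf.1.mono_ac (volume_absolutelyContinuous_gaussMeasure hσ)).mul
    (Continuous.aestronglyMeasurable (by fun_prop)), ?_⟩
  have h := hf.2
  rw [eLpNorm_gaussMeasure σ (norm_chirp σ ha ha' f)] at h
  refine ENNReal.lt_top_of_mul_ne_top_right h.ne ?_
  simp [gaussConst_pos hσ]

/-- The scalar fractional Fourier integral over `[-R, R]`, with leading constant `C`. -/
def frftTrunc (σ : ℝ) (a C : ℂ) (R : ℝ) (f : ℝ → ℂ) (y : ℝ) : ℂ :=
  C * ∫ x in (-R)..R, f x * frftKernel σ a x y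

/-- L² lies in L¹ on a bounded interval; this is why the Fourier integral applies to truncations. -/
theorem integrable_indicator_chirp (hσ : 0 < σ) (ha : ‖a‖ = 1) (ha' : 1 - a ^ 2 ≠ 0)
    (hf : MemLp f 2 (gaussMeasure σ)) (R : ℝ) :
    Integrable ((Set.Ioc (-R) R).indicator (chirp σ a f)) := by
  rw [integrable_indicator_iff measurableSet_Ioc]
  have : IsFiniteMeasure (volume.restrict (Set.Ioc (-R) R)) := by
    constructor; simp
  exact ((memLp_chirp hσ ha ha' hf).restrict _).integrable (by norm_num)

theorem integrableOn_mul_frftKernel (hσ : 0 < σ) (ha : ‖a‖ = 1) (ha' : 1 - a ^ 2 ≠ 0)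
    (hf : MemLp f 2 (gaussMeasure σ)) (R y : ℝ) :
    IntegrableOn (fun x => f x * frftKernel σ a x y) (Set.Ioc (-R) R) := by
  have h := (integrable_indicator_iff measurableSet_Ioc).1
    (integrable_indicator_chirp hσ ha ha' hf R)
  have h2 := (Integrable.mul_bdd (c := 1) h
    (g := fun x => Complex.exp (((2 * σ * ((1 - a ^ 2)⁻¹ * a).im * x * y : ℝ) : ℂ) * Complex.I))
    (Continuous.aestronglyMeasurable (by fun_prop))
    (ae_of_all _ fun x => (Complex.norm_exp_ofReal_mul_I _).le)).const_mul
      (Complex.exp (-(σ * ((1 - a ^ 2)⁻¹ - 1) * y ^ 2)))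
  refine h2.congr (ae_of_all _ fun x => ?_)
  simp only [frftKernel_eq σ ha ha', chirp]
  ring

/-! ### Factorisation through the Fourier integral. -/

/-- The dilation factor that turns the fractional Fourier integral into a Fourier integral. -/
def frftDilation (σ : ℝ) (a : ℂ) : ℝ := -(σ * ((1 - a ^ 2)⁻¹ * a).im / Real.pi)

theorem frftDilation_ne_zero (hσ : 0 < σ) (ha : ‖a‖ = 1) (ha' : 1 - a ^ 2 ≠ 0) :
    frftDilation σ a ≠ 0 :=
  neg_ne_zero.2 (div_ne_zero (mul_ne_zero hσ.ne' (im_inv_one_sub_sq_mul_self_ne_zero ha ha'))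
    Real.pi_ne_zero)

/-- Dilation, followed by multiplication by the chirp in the variable `y`. -/
def dilateChirp (σ : ℝ) (a C : ℂ) (u : ℝ → ℂ) (y : ℝ) : ℂ :=
  C * Complex.exp (-(σ * ((1 - a ^ 2)⁻¹ - 1) * y ^ 2)) * u (frftDilation σ a * y)

theorem frftTrunc_eq (C : ℂ) (ha : ‖a‖ = 1) (ha' : 1 - a ^ 2 ≠ 0) {R : ℝ} (hR : 0 ≤ R) :
    frftTrunc σ a C R f =
      dilateChirp σ a C (𝓕 ((Set.Ioc (-R) R).indicator (chirp σ a f))) := by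
  funext y
  rw [frftTrunc, dilateChirp, mul_assoc, Real.fourier_real_eq_integral_exp_smul,
    intervalIntegral.integral_of_le (by linarith), ← integral_indicator measurableSet_Ioc]
  congr 1
  rw [← integral_const_mul]
  refine integral_congr_ae (ae_of_all _ fun x => ?_)
  by_cases hx : x ∈ Set.Ioc (-R) R
  · simp only [Set.indicator_of_mem hx, frftKernel_eq σ ha ha', chirp, frftDilation, smul_eq_mul]
    -- This identity dictates `frftDilation`: the Fourier phase -2πxw at w = ty must equal the cross
    -- term.
    have : -2 * Real.pi * x * (-(σ * ((1 - a ^ 2)⁻¹ * a).im / Real.pi) * y) =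
        2 * σ * ((1 - a ^ 2)⁻¹ * a).im * x * y := by
      field_simp [Real.pi_ne_zero]
    rw [this]
    ring
  · simp [Set.indicator_of_notMem hx]

/-- The factor by which `dilateChirp` changes the norm. -/
def dilateChirpNorm (σ : ℝ) (a C : ℂ) : ℝ≥0∞ :=
  ENNReal.ofReal (gaussConst σ) ^ (1 / 2 : ℝ) *
    (‖C‖ₑ * ENNReal.ofReal |(frftDilation σ a)⁻¹| ^ (1 / 2 : ℝ))

theorem dilateChirpNorm_ne_top (σ : ℝ) (a C : ℂ) : dilateChirpNorm σ a C ≠ ∞ := by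
  unfold dilateChirpNorm
  finiteness

theorem dilateChirpNorm_ne_zero {C : ℂ} (hσ : 0 < σ) (ha : ‖a‖ = 1) (ha' : 1 - a ^ 2 ≠ 0)
    (hC : C ≠ 0) : dilateChirpNorm σ a C ≠ 0 := by
  have := frftDilation_ne_zero hσ ha ha'
  simp [dilateChirpNorm, gaussConst_pos hσ, hC, this]

/-- Re(c - 1) = -1/2, so the chirp in y exactly cancels the root of the Gaussian weight; dilation by
t ≠ 0 contributes |t|^(-1/2). -/
theorem eLpNorm_dilateChirp (C : ℂ) (hσ : 0 < σ) (ha : ‖a‖ = 1) (ha' : 1 - a ^ 2 ≠ 0)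
    (u : ℝ → ℂ) :
    eLpNorm (dilateChirp σ a C u) 2 (gaussMeasure σ) =
      dilateChirpNorm σ a C * eLpNorm u 2 volume := by
  have ht := frftDilation_ne_zero hσ ha ha'
  rw [eLpNorm_gaussMeasure σ (g := C • fun y => u (frftDilation σ a * y)), eLpNorm_const_smul,
    dilateChirpNorm, mul_assoc, mul_assoc]
  · congr 2
    have := (measurableEmbedding_mulLeft₀ ht).eLpNorm_map_measure (g := u) (p := 2)
      (μ := (volume : Measure ℝ))
    rw [Real.map_volume_mul_left ht, eLpNorm_smul_measure_of_ne_top (by norm_num)] at this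
    simpa [Function.comp_def] using this.symm
  · intro y
    rw [dilateChirp, norm_mul, norm_mul, norm_exp_chirp, Complex.sub_re, re_inv_one_sub_sq ha ha']
    simp only [Pi.smul_apply, smul_eq_mul, norm_mul, Complex.one_re]
    have : Real.exp (-σ * y ^ 2 / 2) * Real.exp (-(σ * (1 / 2 - 1) * y ^ 2)) = 1 := by
      rw [← Real.exp_add, Real.exp_eq_one_iff]
      ring
    linear_combination (-‖C‖ * ‖u (frftDilation σ a * y)‖) * this

theorem aestronglyMeasurable_dilateChirp (C : ℂ) (hσ : 0 < σ) (ha : ‖a‖ = 1)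
    (ha' : 1 - a ^ 2 ≠ 0) {u : ℝ → ℂ} (hu : AEStronglyMeasurable u volume) :
    AEStronglyMeasurable (dilateChirp σ a C u) (gaussMeasure σ) := by
  have ht := frftDilation_ne_zero hσ ha ha'
  have hq : Measure.QuasiMeasurePreserving (fun y : ℝ => frftDilation σ a * y) volume volume :=
    ⟨by fun_prop, by
      rw [Real.map_volume_mul_left ht]
      exact Measure.smul_absolutelyContinuous⟩
  refine AEStronglyMeasurable.mono_ac (gaussMeasure_absolutelyContinuous σ) ?_
  exact (Continuous.aestronglyMeasurable (by fun_prop)).mul (hu.comp_quasiMeasurePreserving hq)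

theorem memLp_indicator_chirp (hσ : 0 < σ) (ha : ‖a‖ = 1) (ha' : 1 - a ^ 2 ≠ 0)
    (hf : MemLp f 2 (gaussMeasure σ)) (R : ℝ) :
    MemLp ((Set.Ioc (-R) R).indicator (chirp σ a f)) 2 volume :=
  (memLp_chirp hσ ha ha' hf).indicator measurableSet_Ioc

theorem aestronglyMeasurable_frftTrunc (C : ℂ) (hσ : 0 < σ) (ha : ‖a‖ = 1) (ha' : 1 - a ^ 2 ≠ 0)
    (hf : MemLp f 2 (gaussMeasure σ)) {R : ℝ} (hR : 0 ≤ R) :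
    AEStronglyMeasurable (frftTrunc σ a C R f) (gaussMeasure σ) := by
  rw [frftTrunc_eq C ha ha' hR]
  refine aestronglyMeasurable_dilateChirp C hσ ha ha' ?_
  exact (Lp.aestronglyMeasurable _).congr (fourier_toLp_ae_eq
    (integrable_indicator_chirp hσ ha ha' hf R) (memLp_indicator_chirp hσ ha ha' hf R))

/-! ### Convergence and injectivity for the scalar transform. -/

/-- The scalar fractional Fourier integrals converge in mean. -/
theorem exists_tendsto_frftTrunc (C : ℂ) (hσ : 0 < σ) (ha : ‖a‖ = 1) (ha' : 1 - a ^ 2 ≠ 0)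
    (hf : MemLp f 2 (gaussMeasure σ)) :
    ∃ g : ℝ → ℂ, MemLp g 2 (gaussMeasure σ) ∧
      Tendsto (fun R : ℝ => eLpNorm (fun y => frftTrunc σ a C R f y - g y) 2 (gaussMeasure σ))
        atTop (𝓝 0) := by
  have hh := memLp_chirp hσ ha ha' hf
  set F : Lp ℂ 2 (volume : Measure ℝ) := 𝓕 (hh.toLp _) with hF
  refine ⟨dilateChirp σ a C F, ⟨aestronglyMeasurable_dilateChirp C hσ ha ha'
    (Lp.aestronglyMeasurable F), ?_⟩, ?_⟩
  · rw [eLpNorm_dilateChirp C hσ ha ha']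
    exact ENNReal.mul_lt_top (dilateChirpNorm_ne_top _ _ _).lt_top (Lp.eLpNorm_lt_top F)
  · have hlim := ENNReal.Tendsto.const_mul (tendsto_eLpNorm_indicator_Ioc_sub hh)
      (Or.inr (dilateChirpNorm_ne_top σ a C))
    rw [mul_zero] at hlim
    refine hlim.congr' ?_
    filter_upwards [eventually_ge_atTop 0] with R hR
    have h1 := integrable_indicator_chirp hσ ha ha' hf R
    have h2 := memLp_indicator_chirp hσ ha ha' hf R
    have hsub : (fun y => frftTrunc σ a C R f y - dilateChirp σ a C F y) = dilateChirp σ a C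
        (fun w => 𝓕 ((Set.Ioc (-R) R).indicator (chirp σ a f)) w - F w) := by
      funext y
      rw [frftTrunc_eq C ha ha' hR]
      simp only [dilateChirp]
      ring
    rw [hsub, eLpNorm_dilateChirp C hσ ha ha']
    congr 1
    -- Passing to classes in L² turns the difference into one Fourier transform, so the isometry
    -- reduces the claim to convergence of the truncated chirps.
    have e1 : (fun w => 𝓕 ((Set.Ioc (-R) R).indicator (chirp σ a f)) w - F w) =ᵐ[volume]
        (𝓕 (h2.toLp _ - hh.toLp _) : Lp ℂ 2 (volume : Measure ℝ)) := by
      have : (𝓕 (h2.toLp _ - hh.toLp _) : Lp ℂ 2 (volume : Measure ℝ)) = 𝓕 (h2.toLp _) - F :=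
        (Lp.fourierTransformₗᵢ ℝ ℂ).map_sub _ _
      rw [this]
      filter_upwards [Lp.coeFn_sub (𝓕 (h2.toLp _)) F, fourier_toLp_ae_eq h1 h2] with w hw hw'
      rw [hw, Pi.sub_apply, hw']
    have e2 : (fun x => (Set.Ioc (-R) R).indicator (chirp σ a f) x - chirp σ a f x) =ᵐ[volume]
        (h2.toLp _ - hh.toLp _ : Lp ℂ 2 (volume : Measure ℝ)) := by
      filter_upwards [Lp.coeFn_sub (h2.toLp _) (hh.toLp _), h2.coeFn_toLp, hh.coeFn_toLp]
        with x hx hx1 hx2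
      rw [hx, Pi.sub_apply, hx1, hx2]
    rw [eLpNorm_congr_ae e1, eLpNorm_congr_ae e2, ← Lp.enorm_def, ← Lp.enorm_def, ← ofReal_norm,
      ← ofReal_norm, Lp.norm_fourier_eq]

/-- A function whose scalar fractional Fourier integrals tend to zero in mean vanishes. -/
theorem ae_eq_zero_of_tendsto_frftTrunc {C : ℂ} (hC : C ≠ 0) (hσ : 0 < σ) (ha : ‖a‖ = 1)
    (ha' : 1 - a ^ 2 ≠ 0) (hf : MemLp f 2 (gaussMeasure σ))
    (hlim : Tendsto (fun R : ℝ => eLpNorm (frftTrunc σ a C R f) 2 (gaussMeasure σ))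
      atTop (𝓝 0)) : f =ᵐ[gaussMeasure σ] 0 := by
  have hh := memLp_chirp hσ ha ha' hf
  have hK0 := dilateChirpNorm_ne_zero hσ ha ha' hC
  have hK := dilateChirpNorm_ne_top σ a C
  have h1 : Tendsto (fun R : ℝ => eLpNorm ((Set.Ioc (-R) R).indicator (chirp σ a f)) 2 volume)
      atTop (𝓝 0) := by
    have := ENNReal.Tendsto.const_mul (a := (dilateChirpNorm σ a C)⁻¹) hlim
      (Or.inr (ENNReal.inv_ne_top.2 hK0))
    rw [mul_zero] at this
    refine this.congr' ?_
    filter_upwards [eventually_ge_atTop 0] with R hR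
    rw [frftTrunc_eq C ha ha' hR, eLpNorm_dilateChirp C hσ ha ha', eLpNorm_fourier_eq
      (integrable_indicator_chirp hσ ha ha' hf R) (memLp_indicator_chirp hσ ha ha' hf R),
      ← mul_assoc, ENNReal.inv_mul_cancel hK0 hK, one_mul]
  -- The truncated chirps tend both to zero and to the full chirp, which therefore has norm zero.
  have h2 := h1.add (tendsto_eLpNorm_indicator_Ioc_sub hh)
  rw [add_zero] at h2
  have h3 : eLpNorm (chirp σ a f) 2 volume ≤ 0 := by
    refine ge_of_tendsto h2 (Eventually.of_forall fun R => ?_)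
    have hm := memLp_indicator_chirp hσ ha ha' hf R
    have hEq : chirp σ a f = (Set.Ioc (-R) R).indicator (chirp σ a f) -
        ((Set.Ioc (-R) R).indicator (chirp σ a f) - chirp σ a f) := by
      abel
    conv_lhs => rw [hEq]
    exact eLpNorm_sub_le hm.1 (hm.1.sub hh.1) (by norm_num)
  have h4 : eLpNorm f 2 (gaussMeasure σ) = 0 := by
    rw [eLpNorm_gaussMeasure σ (norm_chirp σ ha ha' f), nonpos_iff_eq_zero.1 h3, mul_zero]
  exact (eLpNorm_eq_zero_iff hf.1 (by norm_num)).1 h4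

end UnitCircle

/-! ### Idempotent components as ring homomorphisms and linear maps. -/

theorem ext_plus_minus {Z W : Bicomplex} (hp : Z.plus = W.plus) (hm : Z.minus = W.minus) :
    Z = W := by
  rw [← ofIdem_plus_minus Z, hp, hm, ofIdem_plus_minus]

/-- The component `plus` as a ring homomorphism. -/
def plusHom : Bicomplex →+* ℂ where
  toFun := plus
  map_one' := by simp [plus, QuadraticAlgebra.re_one, QuadraticAlgebra.im_one]
  map_zero' := by simp [plus]
  map_add' Z W := by simp [plus]; ring
  map_mul' Z W := by
    simp only [plus, QuadraticAlgebra.re_mul, QuadraticAlgebra.im_mul]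
    linear_combination (-(Z.im * W.im)) * Complex.I_mul_I

/-- The component `minus` as a ring homomorphism. -/
def minusHom : Bicomplex →+* ℂ where
  toFun := minus
  map_one' := by simp [minus, QuadraticAlgebra.re_one, QuadraticAlgebra.im_one]
  map_zero' := by simp [minus]
  map_add' Z W := by simp [minus]; ring
  map_mul' Z W := by
    simp only [minus, QuadraticAlgebra.re_mul, QuadraticAlgebra.im_mul]
    linear_combination (-(Z.im * W.im)) * Complex.I_mul_I

theorem plusHom_algebraMap (r : ℝ) : plusHom (algebraMap ℝ Bicomplex r) = r := by
  change (algebraMap ℝ ℂ r) - Complex.I * 0 = r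
  simp

theorem minusHom_algebraMap (r : ℝ) : minusHom (algebraMap ℝ Bicomplex r) = r := by
  change (algebraMap ℝ ℂ r) + Complex.I * 0 = r
  simp

theorem map_ringInverse {F : Bicomplex →+* ℂ} {Z : Bicomplex} (hZ : IsUnit Z) :
    F (Ring.inverse Z) = (F Z)⁻¹ := by
  refine eq_inv_of_mul_eq_one_left ?_
  rw [← map_mul, Ring.inverse_mul_cancel _ hZ, map_one]

theorem isUnit_of_plus_minus_ne_zero {Z : Bicomplex} (hp : Z.plus ≠ 0) (hm : Z.minus ≠ 0) :
    IsUnit Z := by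
  refine IsUnit.of_mul_eq_one (ofIdem Z.plus⁻¹ Z.minus⁻¹) (ext_plus_minus ?_ ?_)
  · have : plusHom (Z * ofIdem Z.plus⁻¹ Z.minus⁻¹) = plusHom 1 := by
      rw [map_mul, map_one]
      change Z.plus * (ofIdem Z.plus⁻¹ Z.minus⁻¹).plus = 1
      rw [plus_ofIdem, mul_inv_cancel₀ hp]
    exact this
  · have : minusHom (Z * ofIdem Z.plus⁻¹ Z.minus⁻¹) = minusHom 1 := by
      rw [map_mul, map_one]
      change Z.minus * (ofIdem Z.plus⁻¹ Z.minus⁻¹).minus = 1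
      rw [minus_ofIdem, mul_inv_cancel₀ hm]
    exact this

instance : FiniteDimensional ℝ Bicomplex :=
  FiniteDimensional.of_injective toEuclidean toEuclidean_injective

instance : CompleteSpace Bicomplex := FiniteDimensional.complete ℝ Bicomplex

/-- The real linear map underlying a ring homomorphism that fixes the real numbers. -/
def linearMapOfRingHom (F : Bicomplex →+* ℂ) (hF : ∀ r : ℝ, F (algebraMap ℝ Bicomplex r) = r) :
    Bicomplex →ₗ[ℝ] ℂ where
  toFun := F
  map_add' := map_add F
  map_smul' r Z := by
    rw [Algebra.smul_def, map_mul, hF]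
    simp

/-- The component `plus` as a continuous real linear map. -/
def plusCLM : Bicomplex →L[ℝ] ℂ :=
  (linearMapOfRingHom plusHom plusHom_algebraMap).toContinuousLinearMap

/-- The component `minus` as a continuous real linear map. -/
def minusCLM : Bicomplex →L[ℝ] ℂ :=
  (linearMapOfRingHom minusHom minusHom_algebraMap).toContinuousLinearMap

theorem plusCLM_apply (Z : Bicomplex) : plusCLM Z = Z.plus := rfl

theorem minusCLM_apply (Z : Bicomplex) : minusCLM Z = Z.minus := rfl

/-- The map `(α, β) ↦ α e₊ + β e₋` as a continuous real linear map. -/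
def ofIdemCLM : ℂ × ℂ →L[ℝ] Bicomplex :=
  LinearMap.toContinuousLinearMap
    { toFun := fun p => ofIdem p.1 p.2
      map_add' := fun p q => by
        simp only [ofIdem, Prod.fst_add, Prod.snd_add, add_smul]
        abel
      map_smul' := fun r p => by
        simp only [ofIdem, Prod.smul_fst, Prod.smul_snd, smul_assoc, smul_add, RingHom.id_apply] }

theorem ofIdemCLM_apply (p : ℂ × ℂ) : ofIdemCLM p = ofIdem p.1 p.2 := rfl

/-! ### Reduction of the bicomplex transform to its components. -/

variable {σ : ℝ} {θ : Bicomplex}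

theorem plus_one_sub_sq (θ : Bicomplex) : (1 - θ ^ 2).plus = 1 - θ.plus ^ 2 := by
  change plusHom (1 - θ ^ 2) = 1 - plusHom θ ^ 2
  simp

theorem minus_one_sub_sq (θ : Bicomplex) : (1 - θ ^ 2).minus = 1 - θ.minus ^ 2 := by
  change minusHom (1 - θ ^ 2) = 1 - minusHom θ ^ 2
  simp

theorem one_sub_plus_sq_ne_zero (hunit : IsUnit (1 - θ ^ 2)) : 1 - θ.plus ^ 2 ≠ 0 := by
  rw [← plus_one_sub_sq]
  exact (hunit.map plusHom).ne_zero

theorem one_sub_minus_sq_ne_zero (hunit : IsUnit (1 - θ ^ 2)) : 1 - θ.minus ^ 2 ≠ 0 := by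
  rw [← minus_one_sub_sq]
  exact (hunit.map minusHom).ne_zero

/-- A principal root vanishes only at 0. Thus `Ring.inverse` takes no default value in the leading
constant. -/
theorem isUnit_sqrt (hunit : IsUnit (1 - θ ^ 2)) : IsUnit (sqrt (1 - θ ^ 2)) := by
  refine isUnit_of_plus_minus_ne_zero ?_ ?_
  · rw [sqrt, plus_ofIdem, plus_one_sub_sq]
    simp [Complex.cpow_eq_zero_iff, one_sub_plus_sq_ne_zero hunit]
  · rw [sqrt, minus_ofIdem, minus_one_sub_sq]
    simp [Complex.cpow_eq_zero_iff, one_sub_minus_sq_ne_zero hunit]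

theorem plusHom_bfrftKernel (σ : ℝ) (hunit : IsUnit (1 - θ ^ 2)) (x y : ℝ) :
    plusHom (bfrftKernel σ θ x y) = frftKernel σ θ.plus x y := by
  refine (plus_ofIdem _ _).trans ?_
  rw [frftKernel]
  congr 1
  change plusHom _ = _
  simp only [map_neg, map_mul, map_pow, map_sub, map_ringInverse hunit, plusHom_algebraMap,
    map_one]
  rfl

theorem minusHom_bfrftKernel (σ : ℝ) (hunit : IsUnit (1 - θ ^ 2)) (x y : ℝ) :
    minusHom (bfrftKernel σ θ x y) = frftKernel σ θ.minus x y := by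
  refine (minus_ofIdem _ _).trans ?_
  rw [frftKernel]
  congr 1
  change minusHom _ = _
  simp only [map_neg, map_mul, map_pow, map_sub, map_ringInverse hunit, minusHom_algebraMap,
    map_one]
  rfl

/-- The leading constant `(σ / π) ^ (1 / 2) / (1 - a²) ^ (1 / 2)` of the scalar transform. -/
def frftConst (σ : ℝ) (a : ℂ) : ℂ := gaussConst σ * ((1 - a ^ 2) ^ (1 / 2 : ℂ))⁻¹

theorem frftConst_ne_zero {a : ℂ} (hσ : 0 < σ) (ha' : 1 - a ^ 2 ≠ 0) : frftConst σ a ≠ 0 := by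
  simp [frftConst, (gaussConst_pos hσ).ne', Complex.cpow_eq_zero_iff, ha']

variable {ψ : ℝ → Bicomplex}

theorem memLp_plus (hψ : MemLp ψ 2 (gaussMeasure σ)) :
    MemLp (fun x => (ψ x).plus) 2 (gaussMeasure σ) :=
  plusCLM.comp_memLp' hψ

theorem memLp_minus (hψ : MemLp ψ 2 (gaussMeasure σ)) :
    MemLp (fun x => (ψ x).minus) 2 (gaussMeasure σ) :=
  minusCLM.comp_memLp' hψ

/-- Integrability is inherited from the two components; it is what lets the integral commute with
the projections. -/
theorem integrableOn_mul_bfrftKernel (hσ : 0 < σ) (hplus : ‖θ.plus‖ = 1) (hminus : ‖θ.minus‖ = 1)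
    (hunit : IsUnit (1 - θ ^ 2)) (hψ : MemLp ψ 2 (gaussMeasure σ)) (R y : ℝ) :
    IntegrableOn (fun x => ψ x * bfrftKernel σ θ x y) (Set.Ioc (-R) R) := by
  have hp := integrableOn_mul_frftKernel hσ hplus (one_sub_plus_sq_ne_zero hunit)
    (memLp_plus hψ) R y
  have hm := integrableOn_mul_frftKernel hσ hminus (one_sub_minus_sq_ne_zero hunit)
    (memLp_minus hψ) R y
  refine (ofIdemCLM.integrable_comp (hp.prodMk hm)).congr (ae_of_all _ fun x => ?_)
  simp only [ofIdemCLM_apply]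
  refine ext_plus_minus ?_ ?_
  · rw [plus_ofIdem, ← plusHom_bfrftKernel σ hunit]
    exact (map_mul plusHom _ _).symm
  · rw [minus_ofIdem, ← minusHom_bfrftKernel σ hunit]
    exact (map_mul minusHom _ _).symm

theorem plus_bfrftTrunc (hσ : 0 < σ) (hplus : ‖θ.plus‖ = 1) (hminus : ‖θ.minus‖ = 1)
    (hunit : IsUnit (1 - θ ^ 2)) (hψ : MemLp ψ 2 (gaussMeasure σ)) {R : ℝ} (hR : 0 ≤ R) (y : ℝ) :
    (bfrftTrunc σ θ R ψ y).plus =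
      frftTrunc σ θ.plus (frftConst σ θ.plus) R (fun x => (ψ x).plus) y := by
  have hint : plusHom (∫ x in (-R)..R, ψ x * bfrftKernel σ θ x y) =
      ∫ x in (-R)..R, (ψ x).plus * frftKernel σ θ.plus x y := by
    rw [intervalIntegral.integral_of_le (by linarith), intervalIntegral.integral_of_le (by linarith)]
    refine (plusCLM.integral_comp_comm
      (integrableOn_mul_bfrftKernel hσ hplus hminus hunit hψ R y)).symm.trans ?_
    refine integral_congr_ae (ae_of_all _ fun x => ?_)
    simp only [← plusHom_bfrftKernel σ hunit]
    exact map_mul plusHom _ _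
  change plusHom (bfrftTrunc σ θ R ψ y) = _
  rw [bfrftTrunc, map_mul, map_mul, hint, map_ringInverse (isUnit_sqrt hunit), plusHom_algebraMap,
    frftTrunc, frftConst, ← plus_one_sub_sq]
  congr 3
  exact plus_ofIdem _ _

theorem minus_bfrftTrunc (hσ : 0 < σ) (hplus : ‖θ.plus‖ = 1) (hminus : ‖θ.minus‖ = 1)
    (hunit : IsUnit (1 - θ ^ 2)) (hψ : MemLp ψ 2 (gaussMeasure σ)) {R : ℝ} (hR : 0 ≤ R) (y : ℝ) :
    (bfrftTrunc σ θ R ψ y).minus =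
      frftTrunc σ θ.minus (frftConst σ θ.minus) R (fun x => (ψ x).minus) y := by
  have hint : minusHom (∫ x in (-R)..R, ψ x * bfrftKernel σ θ x y) =
      ∫ x in (-R)..R, (ψ x).minus * frftKernel σ θ.minus x y := by
    rw [intervalIntegral.integral_of_le (by linarith), intervalIntegral.integral_of_le (by linarith)]
    refine (minusCLM.integral_comp_comm
      (integrableOn_mul_bfrftKernel hσ hplus hminus hunit hψ R y)).symm.trans ?_
    refine integral_congr_ae (ae_of_all _ fun x => ?_)
    simp only [← minusHom_bfrftKernel σ hunit]
    exact map_mul minusHom _ _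
  change minusHom (bfrftTrunc σ θ R ψ y) = _
  rw [bfrftTrunc, map_mul, map_mul, hint, map_ringInverse (isUnit_sqrt hunit), minusHom_algebraMap,
    frftTrunc, frftConst, ← minus_one_sub_sq]
  congr 3
  exact minus_ofIdem _ _

theorem bfrftTrunc_eq (hσ : 0 < σ) (hplus : ‖θ.plus‖ = 1) (hminus : ‖θ.minus‖ = 1)
    (hunit : IsUnit (1 - θ ^ 2)) (hψ : MemLp ψ 2 (gaussMeasure σ)) {R : ℝ} (hR : 0 ≤ R) (y : ℝ) :
    bfrftTrunc σ θ R ψ y =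
      ofIdem (frftTrunc σ θ.plus (frftConst σ θ.plus) R (fun x => (ψ x).plus) y)
        (frftTrunc σ θ.minus (frftConst σ θ.minus) R (fun x => (ψ x).minus) y) := by
  rw [← plus_bfrftTrunc hσ hplus hminus hunit hψ hR, ← minus_bfrftTrunc hσ hplus hminus hunit hψ hR,
    ofIdem_plus_minus]

theorem aestronglyMeasurable_bfrftTrunc (hσ : 0 < σ) (hplus : ‖θ.plus‖ = 1)
    (hminus : ‖θ.minus‖ = 1) (hunit : IsUnit (1 - θ ^ 2)) (hψ : MemLp ψ 2 (gaussMeasure σ))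
    {R : ℝ} (hR : 0 ≤ R) : AEStronglyMeasurable (bfrftTrunc σ θ R ψ) (gaussMeasure σ) := by
  rw [funext (bfrftTrunc_eq hσ hplus hminus hunit hψ hR)]
  exact ofIdemCLM.continuous.comp_aestronglyMeasurable
    ((aestronglyMeasurable_frftTrunc _ hσ hplus (one_sub_plus_sq_ne_zero hunit)
      (memLp_plus hψ) hR).prodMk
    (aestronglyMeasurable_frftTrunc _ hσ hminus (one_sub_minus_sq_ne_zero hunit)
      (memLp_minus hψ) hR))

theorem eLpNorm_ofIdem_le {μ : Measure ℝ} {u v : ℝ → ℂ} (hu : AEStronglyMeasurable u μ)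
    (hv : AEStronglyMeasurable v μ) :
    eLpNorm (fun y => ofIdem (u y) (v y)) 2 μ ≤
      ENNReal.ofReal ‖ofIdemCLM‖ * (eLpNorm u 2 μ + eLpNorm v 2 μ) := by
  calc eLpNorm (fun y => ofIdem (u y) (v y)) 2 μ
      ≤ ENNReal.ofReal ‖ofIdemCLM‖ * eLpNorm (fun y => ‖u y‖ + ‖v y‖) 2 μ := by
        refine eLpNorm_le_mul_eLpNorm_of_ae_le_mul (ae_of_all _ fun y => ?_) 2
        refine (ofIdemCLM.le_opNorm (u y, v y)).trans ?_
        gcongr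
        rw [Real.norm_of_nonneg (by positivity)]
        exact max_le (le_add_of_nonneg_right (norm_nonneg _))
          (le_add_of_nonneg_left (norm_nonneg _))
    _ ≤ _ := by
        gcongr
        refine (eLpNorm_add_le hu.norm hv.norm (by norm_num)).trans ?_
        rw [eLpNorm_norm, eLpNorm_norm]

/-! ### Convergence and injectivity for the bicomplex transform. -/

/-- The bicomplex fractional Fourier integrals converge in mean. -/
theorem exists_isBFrFT (hσ : 0 < σ) (hplus : ‖θ.plus‖ = 1) (hminus : ‖θ.minus‖ = 1)
    (hunit : IsUnit (1 - θ ^ 2)) (ψ : L2 σ) : ∃ φ : L2 σ, IsBFrFT σ θ ψ φ := by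
  have hψ : MemLp ψ 2 (gaussMeasure σ) := Lp.memLp ψ
  have hp' := one_sub_plus_sq_ne_zero hunit
  have hm' := one_sub_minus_sq_ne_zero hunit
  obtain ⟨gp, hgp, hp⟩ := exists_tendsto_frftTrunc (frftConst σ θ.plus) hσ hplus hp'
    (memLp_plus hψ)
  obtain ⟨gm, hgm, hm⟩ := exists_tendsto_frftTrunc (frftConst σ θ.minus) hσ hminus hm'
    (memLp_minus hψ)
  have hφ : MemLp (fun y => ofIdem (gp y) (gm y)) 2 (gaussMeasure σ) := by
    refine ⟨ofIdemCLM.continuous.comp_aestronglyMeasurable (hgp.1.prodMk hgm.1), ?_⟩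
    refine (eLpNorm_ofIdem_le hgp.1 hgm.1).trans_lt ?_
    exact ENNReal.mul_lt_top ENNReal.ofReal_lt_top (ENNReal.add_lt_top.2 ⟨hgp.2, hgm.2⟩)
  refine ⟨hφ.toLp _, ?_⟩
  have hlim := ENNReal.Tendsto.const_mul (a := ENNReal.ofReal ‖ofIdemCLM‖) (hp.add hm)
    (Or.inr ENNReal.ofReal_ne_top)
  rw [add_zero, mul_zero] at hlim
  refine tendsto_of_tendsto_of_tendsto_of_le_of_le' tendsto_const_nhds hlim
    (Eventually.of_forall fun _ => zero_le) ?_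
  filter_upwards [eventually_ge_atTop 0] with R hR
  refine le_trans (le_of_eq ?_) (eLpNorm_ofIdem_le
    ((aestronglyMeasurable_frftTrunc _ hσ hplus hp' (memLp_plus hψ) hR).sub hgp.1)
    ((aestronglyMeasurable_frftTrunc _ hσ hminus hm' (memLp_minus hψ) hR).sub hgm.1))
  refine eLpNorm_congr_ae ?_
  filter_upwards [hφ.coeFn_toLp] with y hy
  rw [hy, bfrftTrunc_eq hσ hplus hminus hunit hψ hR]
  exact (ofIdemCLM.map_sub (_, _) (gp y, gm y)).symm

theorem bfrftTrunc_sub (hσ : 0 < σ) (hplus : ‖θ.plus‖ = 1) (hminus : ‖θ.minus‖ = 1)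
    (hunit : IsUnit (1 - θ ^ 2)) (ψ₁ ψ₂ : L2 σ) {R : ℝ} (hR : 0 ≤ R) (y : ℝ) :
    bfrftTrunc σ θ R (ψ₁ - ψ₂ : L2 σ) y = bfrftTrunc σ θ R ψ₁ y - bfrftTrunc σ θ R ψ₂ y := by
  simp only [bfrftTrunc]
  rw [← mul_sub]
  congr 1
  simp only [intervalIntegral.integral_of_le (show -R ≤ R by linarith)]
  rw [← integral_sub (integrableOn_mul_bfrftKernel hσ hplus hminus hunit (Lp.memLp ψ₁) R y)
    (integrableOn_mul_bfrftKernel hσ hplus hminus hunit (Lp.memLp ψ₂) R y)]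
  refine integral_congr_ae (ae_restrict_of_ae ?_)
  -- Classes agree Gaussian-almost everywhere, while the integral is over Lebesgue measure; absolute
  -- continuity bridges the two.
  filter_upwards [(volume_absolutelyContinuous_gaussMeasure hσ).ae_le (Lp.coeFn_sub ψ₁ ψ₂)]
    with x hx
  rw [hx, Pi.sub_apply, sub_mul]

/-- Square integrable functions with the same fractional Fourier transform coincide. -/
theorem IsBFrFT.eq_of_eq (hσ : 0 < σ) (hplus : ‖θ.plus‖ = 1) (hminus : ‖θ.minus‖ = 1)
    (hunit : IsUnit (1 - θ ^ 2)) {ψ₁ ψ₂ φ : L2 σ} (h₁ : IsBFrFT σ θ ψ₁ φ)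
    (h₂ : IsBFrFT σ θ ψ₂ φ) : ψ₁ = ψ₂ := by
  have hψ : MemLp (ψ₁ - ψ₂ : L2 σ) 2 (gaussMeasure σ) := Lp.memLp _
  -- The truncated transforms of ψ₁ and ψ₂ share the limit φ, so by linearity those of the
  -- difference tend to zero.
  have hlim : Tendsto (fun R : ℝ => eLpNorm (bfrftTrunc σ θ R (ψ₁ - ψ₂ : L2 σ)) 2
      (gaussMeasure σ)) atTop (𝓝 0) := by
    have h := Tendsto.add h₁ h₂
    rw [add_zero] at h
    refine tendsto_of_tendsto_of_tendsto_of_le_of_le' tendsto_const_nhds h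
      (Eventually.of_forall fun _ => zero_le) ?_
    filter_upwards [eventually_ge_atTop 0] with R hR
    have hEq : bfrftTrunc σ θ R (ψ₁ - ψ₂ : L2 σ) = (fun y => bfrftTrunc σ θ R ψ₁ y - φ y) -
        (fun y => bfrftTrunc σ θ R ψ₂ y - φ y) := by
      funext y
      rw [bfrftTrunc_sub hσ hplus hminus hunit ψ₁ ψ₂ hR]
      simp
    rw [hEq]
    exact eLpNorm_sub_le
      ((aestronglyMeasurable_bfrftTrunc hσ hplus hminus hunit (Lp.memLp ψ₁) hR).sub
        (Lp.aestronglyMeasurable φ))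
      ((aestronglyMeasurable_bfrftTrunc hσ hplus hminus hunit (Lp.memLp ψ₂) hR).sub
        (Lp.aestronglyMeasurable φ)) (by norm_num)
  have hcomp (L : Bicomplex →L[ℝ] ℂ) : Tendsto (fun R : ℝ => eLpNorm
      (fun y => L (bfrftTrunc σ θ R (ψ₁ - ψ₂ : L2 σ) y)) 2 (gaussMeasure σ)) atTop (𝓝 0) := by
    have h := ENNReal.Tendsto.const_mul (a := ENNReal.ofReal ‖L‖) hlim
      (Or.inr ENNReal.ofReal_ne_top)
    rw [mul_zero] at h
    exact tendsto_of_tendsto_of_tendsto_of_le_of_le tendsto_const_nhds h (fun _ => zero_le)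
      fun R => eLpNorm_le_mul_eLpNorm_of_ae_le_mul (ae_of_all _ fun y => L.le_opNorm _) 2
  have hp := ae_eq_zero_of_tendsto_frftTrunc
    (frftConst_ne_zero hσ (one_sub_plus_sq_ne_zero hunit)) hσ hplus
    (one_sub_plus_sq_ne_zero hunit) (memLp_plus hψ) <| (hcomp plusCLM).congr' <| by
      filter_upwards [eventually_ge_atTop 0] with R hR
      simp only [plusCLM_apply, plus_bfrftTrunc hσ hplus hminus hunit hψ hR]
  have hm := ae_eq_zero_of_tendsto_frftTrunc
    (frftConst_ne_zero hσ (one_sub_minus_sq_ne_zero hunit)) hσ hminus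
    (one_sub_minus_sq_ne_zero hunit) (memLp_minus hψ) <| (hcomp minusCLM).congr' <| by
      filter_upwards [eventually_ge_atTop 0] with R hR
      simp only [minusCLM_apply, minus_bfrftTrunc hσ hplus hminus hunit hψ hR]
  rw [← sub_eq_zero, Lp.eq_zero_iff_ae_eq_zero]
  filter_upwards [hp, hm] with x hxp hxm
  refine ext_plus_minus (hxp.trans ?_) (hxm.trans ?_)
  · exact (map_zero plusHom).symm
  · exact (map_zero minusHom).symm

end Bicomplex

end

theorem mainTheorem8 (σ : ℝ) (hσ : 0 < σ) (θ : Bicomplex)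
    (hplus : ‖θ.plus‖ = 1) (hminus : ‖θ.minus‖ = 1) (hunit : IsUnit (1 - θ ^ 2)) :
    (∀ ψ : Bicomplex.L2 σ, Bicomplex.IsBFrFT σ θ ψ (Bicomplex.bfrft σ θ ψ)) ∧
      ∀ ψ₁ ψ₂ : Bicomplex.L2 σ,
        Bicomplex.bfrft σ θ ψ₁ = Bicomplex.bfrft σ θ ψ₂ → ψ₁ = ψ₂ := by
  have hex : ∀ ψ : Bicomplex.L2 σ, Bicomplex.IsBFrFT σ θ ψ (Bicomplex.bfrft σ θ ψ) := by
    intro ψ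
    -- Existence of the limit excludes the conventional value 0 of `bfrft`.
    have h := Bicomplex.exists_isBFrFT hσ hplus hminus hunit ψ
    rw [Bicomplex.bfrft, dif_pos h]
    exact h.choose_spec
  refine ⟨hex, fun ψ₁ ψ₂ h => ?_⟩
  exact Bicomplex.IsBFrFT.eq_of_eq hσ hplus hminus hunit (hex ψ₁) (h ▸ hex ψ₂)
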